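/- Let $n\ge 1$, let $\mathcal H=\{x\in\mathbb R^n : x_1+\dots+x_n=0\}$, and for $a,b\in\mathbb R^n$ let $$d_\triangle(a,b)=\sum_{i=1}^n (b_i-a_i)-n\min_{1\le i\le n}(b_i-a_i)$$ be the asymmetric tropical distance. Let $S\subset\mathcal H$ be nonempty, discrete (every bounded set contains only finitely many points of $S$) and in general position (if $a,b\in S$ are distinct, then $a_i\ne b_i$ for all $i$). For $a\in S$ let $$\mathrm{VR}_S(a)=\{x\in\mathcal H : d_\triangle(x,a)\le d_\triangle(x,b)\text{ for all } b\in S\}$$ be its Voronoi region. The Voronoi cells of the Voronoi diagram $\mathrm{VD}(S)$ are the nonempty sets of the form $\bigcap_{a\in T}\mathrm{VR}_S(a)$ with $\emptyset\ne T\subseteq S$. For $x\in\mathcal H$ let $$D_S(x)=\{a\in S : d_\triangle(x,a)=\min_{b\in S}d_\triangle(x,b)\},$$ and for $T\subseteq S$ let $V_T=\{x\in\mathcal H : D_S(x)=T\}$. The V-cells of Edelsbrunner and Seidel are the equivalence classes of the relation $D_S(x)=D_S(y)$ on $\mathcal H$, that is, the nonempty sets among the $V_T$. Then the Voronoi cells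 in $\mathrm{VD}(S)$ are precisely the topological closures of the V-cells; more precisely, $\bigcap_{a\in T}\mathrm{VR}_S(a)=\overline{V_T}$ for every nonempty $T\subseteq S$. Moreover, if $T\subseteq S$ and $V_T\neq\emptyset$, then $T$ is finite, $|T|\le n$, and both $V_T$ and its closure $\overline{V_T}$ are polyhedral sets of pure dimension $n-|T|$; that is, near each of its points, each of these sets coincides with a finite union of nonempty convex polyhedra of dimension $n-|T|$. -/

import Mathlib

open Topology

/-- The hyperplane `x₁ + ⋯ + xₙ = 0` of `ℝⁿ`, representing the tropical projective torus. -/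
def tropH (n : ℕ) : Set (Fin n → ℝ) :=
  {x | ∑ i, x i = 0}

/-- The asymmetric tropical distance
`d(a, b) = ∑ᵢ (bᵢ - aᵢ) - n * minᵢ (bᵢ - aᵢ)`. -/
noncomputable def tropDist {n : ℕ} (a b : Fin n → ℝ) : ℝ :=
  ∑ i, (b i - a i) - (n : ℝ) * ⨅ i, (b i - a i)

/-- Distinct points of `S` differ in every coordinate. -/
def InGeneralPosition {n : ℕ} (S : Set (Fin n → ℝ)) : Prop :=
  ∀ a ∈ S, ∀ b ∈ S, a ≠ b → ∀ i, a i ≠ b i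

/-- Discreteness of a set of sites: every bounded region contains only finitely many sites
(equivalently, `S` is closed and its subspace topology is discrete). -/
def IsDiscreteSites {n : ℕ} (S : Set (Fin n → ℝ)) : Prop :=
  ∀ B : Set (Fin n → ℝ), Bornology.IsBounded B → (S ∩ B).Finite

/-- The asymmetric tropical Voronoi region of the site `a`. -/
def voronoiRegion {n : ℕ} (S : Set (Fin n → ℝ)) (a : Fin n → ℝ) : Set (Fin n → ℝ) :=
  {x | x ∈ tropH n ∧ ∀ b ∈ S, tropDist x a ≤ tropDist x b}

/-- The (nonempty) Voronoi cells: nonempty intersections of nonempty, possibly infinite,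
families of Voronoi regions. -/
def voronoiCells {n : ℕ} (S : Set (Fin n → ℝ)) : Set (Set (Fin n → ℝ)) :=
  {W | W.Nonempty ∧ ∃ T ⊆ S, T.Nonempty ∧ W = ⋂ a ∈ T, voronoiRegion S a}

/-- The set `D_S(x)` of the sites at minimal distance from `x`. -/
def nearestSites {n : ℕ} (S : Set (Fin n → ℝ)) (x : Fin n → ℝ) : Set (Fin n → ℝ) :=
  {a | a ∈ S ∧ IsLeast (tropDist x '' S) (tropDist x a)}

/-- `V_T`, the set of the points of the hyperplane whose set of nearest sites is `T`. -/
def vCell {n : ℕ} (S T : Set (Fin n → ℝ)) : Set (Fin n → ℝ) :=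
  {x | x ∈ tropH n ∧ nearestSites S x = T}

/-- The V-cells: the equivalence classes of the relation `D_S(x) = D_S(y)` on the hyperplane. -/
def vCells {n : ℕ} (S : Set (Fin n → ℝ)) : Set (Set (Fin n → ℝ)) :=
  {V | ∃ x ∈ tropH n, V = {y | y ∈ tropH n ∧ nearestSites S y = nearestSites S x}}

/-- Convex polyhedra in `ℝⁿ`: intersections of finitely many closed affine halfspaces (the zero
normal vector is allowed). -/
def IsPolyhedron {n : ℕ} (P : Set (Fin n → ℝ)) : Prop :=
  ∃ F : Finset ((Fin n → ℝ) × ℝ), P = {x | ∀ h ∈ F, ∑ i, h.1 i * x i ≤ h.2}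

/-- `X` is a nonempty polyhedral set of pure dimension `d`: near each of its points it is a finite
union of nonempty convex polyhedra whose affine hulls all have dimension `d`. -/
def HasPurePolyhedralDim {n : ℕ} (X : Set (Fin n → ℝ)) (d : ℕ) : Prop :=
  X.Nonempty ∧ ∀ x ∈ X, ∃ U ∈ 𝓝 x, ∃ F : Set (Set (Fin n → ℝ)), F.Finite ∧
    (∀ P ∈ F, IsPolyhedron P ∧ P.Nonempty ∧
      Module.finrank ℝ (affineSpan ℝ P).direction = d) ∧
    X ∩ U = ⋃₀ F ∩ U

/-!
For points of the hyperplane `∑ xᵢ = 0`, the distance `tropDist x a` is `n` times the excess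
`maxᵢ (xᵢ - aᵢ)`, so the nearest sites of `x` are the sites of least excess `r`. Call a coordinate
`i` active at `x` for the nearest site `a` if `xᵢ - aᵢ = r`. Since two distinct sites differ in
every coordinate, no coordinate is active for two nearest sites. Hence any choice `ψ` of an active
coordinate for each nearest site is injective, and there are at most `n` nearest sites.

Discreteness makes the set of nearest sites upper semicontinuous: near `x`, every nearest site of
`y` is already a nearest site of `x` (`eventually_nearestSites_subset`). Now let `T` be a nonempty
set of nearest sites of `x`, and move `x` in the direction that fixes the coordinates `ψ a` for
`a ∈ T`, raises the coordinates `ψ b` for the nearest sites `b ∉ T`, lowers all the others, and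
is then projected back to the hyperplane. This keeps the excesses of the sites of `T` equal and
makes those of the other nearest sites larger, so the moved point lies in `vCell S T`
(`eventually_perturb_strict`, `mem_closure_vCell`). This proves that the closure of `vCell S T`
consists of the points whose set of nearest sites contains `T`.

Near `x` that set is the union, over the finitely many active choices `ψ`, of the polyhedra
`cellFace D T ψ` on which, for each `a ∈ T`, the coordinate `ψ a` attains the excess of `a`, and
the excess of `a` is at most the `ψ b`-coordinate of `y - b` for all nearest sites `b` of `x`.
The moved point satisfies all the non-implicit inequalities of such a polyhedron strictly, so its
affine hull is cut out of the hyperplane by the equality of the coordinates `ψ a - a (ψ a)`,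
`a ∈ T`, and has dimension `n - |T|` (`finrank_affineSpan_cellFace`).
-/

open Filter

/-! ### The excess of a point over a site -/

/-- The largest coordinate of `x - a`. -/
noncomputable def excess {n : ℕ} (x a : Fin n → ℝ) : ℝ := ⨆ i, (x i - a i)

theorem le_excess {n : ℕ} (x a : Fin n → ℝ) (i : Fin n) : x i - a i ≤ excess x a :=
  le_ciSup (f := fun i => x i - a i) (Set.finite_range _).bddAbove i

theorem excess_le {n : ℕ} (hn : 1 ≤ n) {x a : Fin n → ℝ} {c : ℝ} (h : ∀ i, x i - a i ≤ c) :
    excess x a ≤ c := by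
  have : Nonempty (Fin n) := ⟨⟨0, hn⟩⟩
  exact ciSup_le h

theorem exists_eq_excess {n : ℕ} (hn : 1 ≤ n) (x a : Fin n → ℝ) :
    ∃ i, x i - a i = excess x a := by
  have : Nonempty (Fin n) := ⟨⟨0, hn⟩⟩
  exact exists_eq_ciSup_of_finite

theorem tropDist_eq_mul_excess {n : ℕ} (hn : 1 ≤ n) {x a : Fin n → ℝ} (hx : x ∈ tropH n)
    (ha : a ∈ tropH n) : tropDist x a = n * excess x a := by
  have : Nonempty (Fin n) := ⟨⟨0, hn⟩⟩
  have hinf : (⨅ i, (a i - x i)) = -excess x a := by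
    apply le_antisymm
    · obtain ⟨i, hi⟩ := exists_eq_excess hn x a
      have := ciInf_le (f := fun i => a i - x i) (Set.finite_range _).bddBelow i
      linarith
    · exact le_ciInf fun i => by linarith [le_excess x a i]
  have hx' : ∑ i, x i = 0 := hx
  have ha' : ∑ i, a i = 0 := ha
  rw [tropDist, hinf, Finset.sum_sub_distrib, hx', ha']
  ring

theorem tropDist_le_tropDist_iff {n : ℕ} (hn : 1 ≤ n) {x a b : Fin n → ℝ} (hx : x ∈ tropH n)
    (ha : a ∈ tropH n) (hb : b ∈ tropH n) :
    tropDist x a ≤ tropDist x b ↔ excess x a ≤ excess x b := by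
  rw [tropDist_eq_mul_excess hn hx ha, tropDist_eq_mul_excess hn hx hb]
  exact mul_le_mul_iff_right₀ (by exact_mod_cast hn)

theorem excess_le_add_dist {n : ℕ} (hn : 1 ≤ n) (x y a : Fin n → ℝ) :
    excess x a ≤ excess y a + dist x y := by
  refine excess_le hn fun i => ?_
  have h1 := le_excess y a i
  have h2 := (le_abs_self _).trans ((Real.dist_eq (x i) (y i)).symm.le.trans (dist_le_pi_dist x y i))
  linarith

theorem continuous_excess {n : ℕ} (hn : 1 ≤ n) (a : Fin n → ℝ) :
    Continuous fun x => excess x a :=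
  (LipschitzWith.of_le_add fun x y => excess_le_add_dist hn x y a).continuous

theorem isClosed_tropH (n : ℕ) : IsClosed (tropH n) :=
  isClosed_eq (by fun_prop) continuous_const

/-! ### Nearest sites -/

theorem mem_nearestSites_iff {n : ℕ} (hn : 1 ≤ n) {S : Set (Fin n → ℝ)} (hSH : S ⊆ tropH n)
    {x a : Fin n → ℝ} (hx : x ∈ tropH n) :
    a ∈ nearestSites S x ↔ a ∈ S ∧ ∀ b ∈ S, excess x a ≤ excess x b := by
  constructor
  · rintro ⟨ha, -, hl⟩
    exact ⟨ha, fun b hb => (tropDist_le_tropDist_iff hn hx (hSH ha) (hSH hb)).1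
      (hl ⟨b, hb, rfl⟩)⟩
  · rintro ⟨ha, h⟩
    refine ⟨ha, ⟨a, ha, rfl⟩, ?_⟩
    rintro _ ⟨b, hb, rfl⟩
    exact (tropDist_le_tropDist_iff hn hx (hSH ha) (hSH hb)).2 (h b hb)

theorem mem_iInter_voronoiRegion_iff {n : ℕ} {S T : Set (Fin n → ℝ)} (hTS : T ⊆ S)
    (hT : T.Nonempty) {x : Fin n → ℝ} :
    x ∈ ⋂ a ∈ T, voronoiRegion S a ↔ x ∈ tropH n ∧ T ⊆ nearestSites S x := by
  simp only [Set.mem_iInter]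
  constructor
  · intro h
    obtain ⟨a, ha⟩ := hT
    refine ⟨(h a ha).1, fun b hb => ⟨hTS hb, ⟨b, hTS hb, rfl⟩, ?_⟩⟩
    rintro _ ⟨c, hc, rfl⟩
    exact (h b hb).2 c hc
  · rintro ⟨hx, h⟩ a ha
    exact ⟨hx, fun b hb => (h ha).2.2 ⟨b, hb, rfl⟩⟩

/-- A bound on the excess bounds all coordinates of a site from below; as they sum to zero, it
bounds them from above as well. -/
theorem finite_excess_le {n : ℕ} {S : Set (Fin n → ℝ)} (hSH : S ⊆ tropH n)
    (hdisc : IsDiscreteSites S) (x : Fin n → ℝ) (c : ℝ) : {a ∈ S | excess x a ≤ c}.Finite := by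
  let l : Fin n → ℝ := fun i => x i - c
  refine (hdisc (Set.Icc l fun i => l i - ∑ j, l j) (Metric.isBounded_Icc _ _)).subset ?_
  rintro a ⟨ha, hac⟩
  have hl : ∀ i, l i ≤ a i := fun i => by
    have := le_excess x a i
    simp only [l]
    linarith
  refine ⟨ha, hl, fun i => ?_⟩
  have hsum : ∑ j, a j = 0 := hSH ha
  have h := Finset.single_le_sum (f := fun j => a j - l j)
    (fun j _ => sub_nonneg.2 (hl j)) (Finset.mem_univ i)
  simp only [Finset.sum_sub_distrib, hsum] at h
  linarith

theorem nearestSites_nonempty {n : ℕ} (hn : 1 ≤ n) {S : Set (Fin n → ℝ)} (hSH : S ⊆ tropH n)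
    (hne : S.Nonempty) (hdisc : IsDiscreteSites S) {x : Fin n → ℝ} (hx : x ∈ tropH n) :
    (nearestSites S x).Nonempty := by
  obtain ⟨s, hs⟩ := hne
  obtain ⟨a, ⟨ha, has⟩, hmin⟩ := Set.exists_min_image {a ∈ S | excess x a ≤ excess x s} (excess x)
    (finite_excess_le hSH hdisc x _) ⟨s, hs, le_rfl⟩
  refine ⟨a, (mem_nearestSites_iff hn hSH hx).2 ⟨ha, fun b hb => ?_⟩⟩
  rcases le_total (excess x b) (excess x s) with h | h
  · exact hmin b ⟨hb, h⟩
  · exact has.trans h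

theorem excess_eq_of_mem_nearestSites {n : ℕ} (hn : 1 ≤ n) {S : Set (Fin n → ℝ)}
    (hSH : S ⊆ tropH n) {x a b : Fin n → ℝ} (hx : x ∈ tropH n) (ha : a ∈ nearestSites S x)
    (hb : b ∈ nearestSites S x) : excess x a = excess x b := by
  rw [mem_nearestSites_iff hn hSH hx] at ha hb
  exact le_antisymm (ha.2 b hb.1) (hb.2 a ha.1)

/-- Upper semicontinuity of the set of nearest sites. Only the finitely many sites whose excess at
`x` exceeds the least one by at most `1` can be nearest to a point close to `x`. -/
theorem eventually_nearestSites_subset {n : ℕ} (hn : 1 ≤ n) {S : Set (Fin n → ℝ)}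
    (hSH : S ⊆ tropH n) (hne : S.Nonempty) (hdisc : IsDiscreteSites S) {x : Fin n → ℝ}
    (hx : x ∈ tropH n) :
    ∀ᶠ y in 𝓝 x, y ∈ tropH n → nearestSites S y ⊆ nearestSites S x := by
  obtain ⟨a, ha⟩ := nearestSites_nonempty hn hSH hne hdisc hx
  have ha' := (mem_nearestSites_iff hn hSH hx).1 ha
  have hB := finite_excess_le hSH hdisc x (excess x a + 1)
  have hfar : ∀ᶠ y in 𝓝 x, ∀ b ∈ {b ∈ S | excess x b ≤ excess x a + 1},
      b ∉ nearestSites S x → excess y a < excess y b := by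
    refine (eventually_all_finite hB).2 fun b hb => ?_
    by_cases hbx : b ∈ nearestSites S x
    · exact Eventually.of_forall fun y h => absurd hbx h
    · have hlt : excess x a < excess x b := by
        by_contra! h
        exact hbx ((mem_nearestSites_iff hn hSH hx).2 ⟨hb.1, fun c hc => h.trans (ha'.2 c hc)⟩)
      filter_upwards [(continuous_excess hn a).continuousAt.eventually_lt
        (continuous_excess hn b).continuousAt hlt] with y hy _ using hy
  filter_upwards [hfar, Metric.ball_mem_nhds x (by norm_num : (0 : ℝ) < 1 / 2)] with y hy hd hyH
  intro b hb
  by_contra hbx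
  rw [mem_nearestSites_iff hn hSH hyH] at hb
  have h1 := hb.2 a ha'.1
  have h2 := excess_le_add_dist hn x y b
  have h3 := excess_le_add_dist hn y x a
  rw [Metric.mem_ball] at hd
  rw [dist_comm] at h2
  exact absurd h1 (not_le.2 (hy b ⟨hb.1, by linarith⟩ hbx))

/-! ### Active coordinates -/

/-- `ψ` selects, for each site in `D`, a coordinate in which the excess of `x` is attained. -/
def IsActiveChoice {n : ℕ} (x : Fin n → ℝ) (D : Set (Fin n → ℝ)) (ψ : (Fin n → ℝ) → Fin n) :
    Prop :=
  ∀ b ∈ D, x (ψ b) - b (ψ b) = excess x b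

theorem exists_isActiveChoice {n : ℕ} (hn : 1 ≤ n) (x : Fin n → ℝ) (D : Set (Fin n → ℝ)) :
    ∃ ψ, IsActiveChoice x D ψ := by
  choose ψ hψ using exists_eq_excess hn x
  exact ⟨ψ, fun b _ => hψ b⟩

/-- In general position a coordinate is active for at most one nearest site. -/
theorem eq_of_active {n : ℕ} (hn : 1 ≤ n) {S : Set (Fin n → ℝ)} (hSH : S ⊆ tropH n)
    (hgen : InGeneralPosition S) {x a b : Fin n → ℝ} (hx : x ∈ tropH n)
    (ha : a ∈ nearestSites S x) (hb : b ∈ nearestSites S x) {i : Fin n}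
    (hai : x i - a i = excess x a) (hbi : x i - b i = excess x b) : a = b := by
  by_contra hab
  have h := excess_eq_of_mem_nearestSites hn hSH hx ha hb
  exact hgen a ha.1 b hb.1 hab i (by linarith)

theorem IsActiveChoice.injOn {n : ℕ} (hn : 1 ≤ n) {S : Set (Fin n → ℝ)} (hSH : S ⊆ tropH n)
    (hgen : InGeneralPosition S) {x : Fin n → ℝ} (hx : x ∈ tropH n) {ψ : (Fin n → ℝ) → Fin n}
    (hψ : IsActiveChoice x (nearestSites S x) ψ) : Set.InjOn ψ (nearestSites S x) :=
  fun a ha b hb hab => eq_of_active hn hSH hgen hx ha hb (hψ a ha) (hab ▸ hψ b hb)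

theorem finite_nearestSites {n : ℕ} (hn : 1 ≤ n) {S : Set (Fin n → ℝ)} (hSH : S ⊆ tropH n)
    (hgen : InGeneralPosition S) {x : Fin n → ℝ} (hx : x ∈ tropH n) :
    (nearestSites S x).Finite := by
  obtain ⟨ψ, hψ⟩ := exists_isActiveChoice hn x (nearestSites S x)
  exact Set.Finite.of_finite_image (Set.toFinite _) (hψ.injOn hn hSH hgen hx)

theorem ncard_nearestSites_le {n : ℕ} (hn : 1 ≤ n) {S : Set (Fin n → ℝ)} (hSH : S ⊆ tropH n)
    (hgen : InGeneralPosition S) {x : Fin n → ℝ} (hx : x ∈ tropH n) :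
    (nearestSites S x).ncard ≤ n := by
  obtain ⟨ψ, hψ⟩ := exists_isActiveChoice hn x (nearestSites S x)
  rw [← (hψ.injOn hn hSH hgen hx).ncard_image]
  simpa using Set.ncard_le_card (ψ '' nearestSites S x)

/-- The coordinates attaining the excess of `y` over a site are active at `x` if `y` is close
to `x`. -/
theorem eventually_active {n : ℕ} (hn : 1 ≤ n) {D : Set (Fin n → ℝ)} (hD : D.Finite)
    (x : Fin n → ℝ) :
    ∀ᶠ y in 𝓝 x, ∀ b ∈ D, ∀ i, y i - b i = excess y b → x i - b i = excess x b := by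
  refine (eventually_all_finite hD).2 fun b _ => eventually_all.2 fun i => ?_
  rcases (le_excess x b i).lt_or_eq with h | h
  · have hc : Continuous fun y : Fin n → ℝ => y i - b i := by fun_prop
    filter_upwards [hc.continuousAt.eventually_lt (continuous_excess hn b).continuousAt h]
      with y hy he
    exact absurd he hy.ne
  · exact Eventually.of_forall fun _ _ => h

/-! ### Moving a point into a V-cell -/

/-- The direction in the hyperplane which, up to a multiple of the all-ones vector, fixes the
coordinates in `ψ '' T`, raises those in `ψ '' D \ ψ '' T` and lowers all others. -/
noncomputable def perturbDir {n : ℕ} (D T : Set (Fin n → ℝ)) (ψ : (Fin n → ℝ) → Fin n) :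
    Fin n → ℝ :=
  open Classical in
  let w : Fin n → ℝ := fun i => if i ∈ ψ '' T then 0 else if i ∈ ψ '' D then 1 else -1
  fun i => w i - (∑ j, w j) / n

theorem sum_sub_average {n : ℕ} (hn : 1 ≤ n) (w : Fin n → ℝ) :
    ∑ i, (w i - (∑ j, w j) / n) = 0 := by
  have : (n : ℝ) ≠ 0 := by positivity
  simp only [Finset.sum_sub_distrib, Finset.sum_const, Finset.card_univ, Fintype.card_fin,
    nsmul_eq_mul]
  field_simp
  ring

theorem add_smul_mem_tropH {n : ℕ} {x v : Fin n → ℝ} (hx : x ∈ tropH n) (hv : v ∈ tropH n)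
    (t : ℝ) : x + t • v ∈ tropH n := by
  have hx' : ∑ i, x i = 0 := hx
  have hv' : ∑ i, v i = 0 := hv
  simp [tropH, Finset.sum_add_distrib, ← Finset.mul_sum, hx', hv']

theorem perturbDir_mem_tropH {n : ℕ} (hn : 1 ≤ n) (D T : Set (Fin n → ℝ))
    (ψ : (Fin n → ℝ) → Fin n) : perturbDir D T ψ ∈ tropH n :=
  sum_sub_average hn _

theorem eventually_add_mul_lt {p q s t : ℝ} (hpq : p ≤ q) (hst : p = q → s < t) :
    ∀ᶠ ε in 𝓝[>] (0 : ℝ), p + ε * s < q + ε * t := by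
  rcases hpq.lt_or_eq with h | h
  · refine nhdsWithin_le_nhds (ContinuousAt.eventually_lt (f := fun ε : ℝ => p + ε * s)
      (g := fun ε : ℝ => q + ε * t) (by fun_prop) (by fun_prop) (by simpa using h))
  · filter_upwards [self_mem_nhdsWithin] with ε hε
    have := mul_lt_mul_of_pos_left (hst h) (Set.mem_Ioi.1 hε)
    linarith

/-- The inequalities that define `cellFace D T ψ`, apart from those that hold with equality on all
of it, in their strict form. -/
def IsStrictIn {n : ℕ} (D T : Set (Fin n → ℝ)) (ψ : (Fin n → ℝ) → Fin n) (z : Fin n → ℝ) :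
    Prop :=
  (∀ a ∈ T, ∀ i, i ≠ ψ a → z i - a i < z (ψ a) - a (ψ a)) ∧
    ∀ a ∈ T, ∀ b ∈ D \ T, z (ψ a) - a (ψ a) < z (ψ b) - b (ψ b)

/-- Moving along `perturbDir` makes the non-implicit inequalities strict. General position enters
here: an inequality `x i - a i ≤ x (ψ a) - a (ψ a)` that is tight at `x` with `i ≠ ψ a` has
`i ∉ ψ '' D`, so that the coordinate `i` is lowered. -/
theorem eventually_perturb_strict {n : ℕ} (hn : 1 ≤ n) {S : Set (Fin n → ℝ)}
    (hSH : S ⊆ tropH n) (hgen : InGeneralPosition S) {x : Fin n → ℝ} (hx : x ∈ tropH n)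
    {T : Set (Fin n → ℝ)} (hT : T ⊆ nearestSites S x) {ψ : (Fin n → ℝ) → Fin n}
    (hψ : IsActiveChoice x (nearestSites S x) ψ) :
    ∀ᶠ ε in 𝓝[>] (0 : ℝ), IsStrictIn (nearestSites S x) T ψ
      (x + ε • perturbDir (nearestSites S x) T ψ) := by
  have hD := finite_nearestSites hn hSH hgen hx
  have hinj := hψ.injOn hn hSH hgen hx
  refine Filter.Eventually.and ?_ ?_
  · refine (eventually_all_finite (hD.subset hT)).2 fun a ha => eventually_all.2 fun i => ?_
    by_cases hi : i = ψ a
    · exact Eventually.of_forall fun _ h => absurd hi h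
    have key := eventually_add_mul_lt (p := x i - a i) (q := x (ψ a) - a (ψ a))
      (s := perturbDir (nearestSites S x) T ψ i) (t := perturbDir (nearestSites S x) T ψ (ψ a))
      ((le_excess x a i).trans (hψ a (hT ha)).ge) (fun he => by
        have hiD : i ∉ ψ '' nearestSites S x := by
          rintro ⟨b, hb, rfl⟩
          exact hi (congrArg ψ (eq_of_active hn hSH hgen hx (hT ha) hb
            (he.trans (hψ a (hT ha))) (hψ b hb)).symm)
        have hiT : i ∉ ψ '' T := fun h => hiD (Set.image_mono hT h)
        have haT : ψ a ∈ ψ '' T := ⟨a, ha, rfl⟩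
        simp only [perturbDir, if_neg hiD, if_neg hiT, if_pos haT]
        linarith)
    filter_upwards [key] with ε hε _
    simp only [Pi.add_apply, Pi.smul_apply, smul_eq_mul]
    linarith
  · refine (eventually_all_finite (hD.subset hT)).2 fun a ha =>
      (eventually_all_finite (hD.subset Set.sdiff_subset)).2 fun b hb => ?_
    have key := eventually_add_mul_lt (p := x (ψ a) - a (ψ a)) (q := x (ψ b) - b (ψ b))
      (s := perturbDir (nearestSites S x) T ψ (ψ a))
      (t := perturbDir (nearestSites S x) T ψ (ψ b))
      (by rw [hψ a (hT ha), hψ b hb.1]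
          exact (excess_eq_of_mem_nearestSites hn hSH hx (hT ha) hb.1).le) (fun _ => by
        have hbT : ψ b ∉ ψ '' T := by
          rintro ⟨c, hc, hcb⟩
          exact hb.2 (hinj (hT hc) hb.1 hcb ▸ hc)
        have hbD : ψ b ∈ ψ '' nearestSites S x := ⟨b, hb.1, rfl⟩
        have haT : ψ a ∈ ψ '' T := ⟨a, ha, rfl⟩
        simp only [perturbDir, if_neg hbT, if_pos hbD, if_pos haT]
        linarith)
    filter_upwards [key] with ε hε
    simp only [Pi.add_apply, Pi.smul_apply, smul_eq_mul]
    linarith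

theorem IsStrictIn.excess_eq {n : ℕ} (hn : 1 ≤ n) {D T : Set (Fin n → ℝ)}
    {ψ : (Fin n → ℝ) → Fin n} {z : Fin n → ℝ} (hz : IsStrictIn D T ψ z) {a : Fin n → ℝ}
    (ha : a ∈ T) : excess z a = z (ψ a) - a (ψ a) := by
  refine le_antisymm (excess_le hn fun i => ?_) (le_excess z a _)
  by_cases hi : i = ψ a
  · rw [hi]
  · exact (hz.1 a ha i hi).le

theorem perturbDir_apply_eq {n : ℕ} {D T : Set (Fin n → ℝ)} {ψ : (Fin n → ℝ) → Fin n}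
    {a b : Fin n → ℝ} (ha : a ∈ T) (hb : b ∈ T) :
    perturbDir D T ψ (ψ a) = perturbDir D T ψ (ψ b) := by
  have haT : ψ a ∈ ψ '' T := ⟨a, ha, rfl⟩
  have hbT : ψ b ∈ ψ '' T := ⟨b, hb, rfl⟩
  simp only [perturbDir, if_pos haT, if_pos hbT]

theorem mem_closure_vCell {n : ℕ} (hn : 1 ≤ n) {S : Set (Fin n → ℝ)} (hSH : S ⊆ tropH n)
    (hne : S.Nonempty) (hdisc : IsDiscreteSites S) (hgen : InGeneralPosition S)
    {x : Fin n → ℝ} (hx : x ∈ tropH n) {T : Set (Fin n → ℝ)} (hT : T ⊆ nearestSites S x)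
    (hTne : T.Nonempty) : x ∈ closure (vCell S T) := by
  obtain ⟨ψ, hψ⟩ := exists_isActiveChoice hn x (nearestSites S x)
  set w := perturbDir (nearestSites S x) T ψ with hw
  have hlim : Tendsto (fun ε : ℝ => x + ε • w) (𝓝[>] 0) (𝓝 x) := by
    have hc : Continuous fun ε : ℝ => x + ε • w := by fun_prop
    simpa using (hc.tendsto 0).mono_left nhdsWithin_le_nhds
  refine mem_closure_of_tendsto hlim ?_
  filter_upwards [eventually_perturb_strict hn hSH hgen hx hT hψ,
    hlim.eventually (eventually_nearestSites_subset hn hSH hne hdisc hx)] with ε hs hsub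
  have hz : x + ε • w ∈ tropH n := add_smul_mem_tropH hx (perturbDir_mem_tropH hn _ _ _) ε
  have heq : ∀ a ∈ T, ∀ b ∈ T, excess (x + ε • w) a = excess (x + ε • w) b := by
    intro a ha b hb
    rw [hs.excess_eq hn ha, hs.excess_eq hn hb]
    have h1 := hψ a (hT ha)
    have h2 := hψ b (hT hb)
    have h3 := excess_eq_of_mem_nearestSites hn hSH hx (hT ha) (hT hb)
    have h4 : w (ψ a) = w (ψ b) := perturbDir_apply_eq ha hb
    simp only [← hw, Pi.add_apply, Pi.smul_apply, smul_eq_mul, h4]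
    linarith
  have hlt : ∀ a ∈ T, ∀ b ∈ nearestSites S x \ T,
      excess (x + ε • w) a < excess (x + ε • w) b := fun a ha b hb => by
    rw [hs.excess_eq hn ha]
    exact (hs.2 a ha b hb).trans_le (le_excess _ b _)
  have hsubT : nearestSites S (x + ε • w) ⊆ T := by
    intro b hb
    by_contra hbT
    obtain ⟨a, ha⟩ := hTne
    exact absurd (((mem_nearestSites_iff hn hSH hz).1 hb).2 a (hT ha).1)
      (not_le.2 (hlt a ha b ⟨hsub hz hb, hbT⟩))
  refine ⟨hz, hsubT.antisymm fun a ha => ?_⟩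
  obtain ⟨b, hb⟩ := nearestSites_nonempty hn hSH hne hdisc hz
  rw [mem_nearestSites_iff hn hSH hz] at hb ⊢
  exact ⟨(hT ha).1, fun c hc => (heq a ha b (hsubT ((mem_nearestSites_iff hn hSH hz).2 hb))).trans_le
    (hb.2 c hc)⟩

theorem iInter_voronoiRegion_eq_closure {n : ℕ} (hn : 1 ≤ n) {S : Set (Fin n → ℝ)}
    (hSH : S ⊆ tropH n) (hne : S.Nonempty) (hdisc : IsDiscreteSites S)
    (hgen : InGeneralPosition S) {T : Set (Fin n → ℝ)} (hTS : T ⊆ S) (hT : T.Nonempty) :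
    (⋂ a ∈ T, voronoiRegion S a) = closure (vCell S T) := by
  ext x
  rw [mem_iInter_voronoiRegion_iff hTS hT]
  refine ⟨fun h => mem_closure_vCell hn hSH hne hdisc hgen h.1 h.2 hT, fun h => ?_⟩
  have hx : x ∈ tropH n := closure_minimal (fun y hy => hy.1) (isClosed_tropH n) h
  refine ⟨hx, ?_⟩
  obtain ⟨y, hyT, hy⟩ := ((mem_closure_iff_frequently.1 h).and_eventually
    (eventually_nearestSites_subset hn hSH hne hdisc hx)).exists
  exact hyT.2 ▸ hy hyT.1

/-! ### Polyhedra -/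

theorem isPolyhedron_halfspace {n : ℕ} (c : Fin n → ℝ) (d : ℝ) :
    IsPolyhedron {y : Fin n → ℝ | ∑ i, c i * y i ≤ d} :=
  ⟨{(c, d)}, by simp⟩

theorem IsPolyhedron.iInter {n : ℕ} {ι : Type*} [Finite ι] {P : ι → Set (Fin n → ℝ)}
    (hP : ∀ k, IsPolyhedron (P k)) : IsPolyhedron (⋂ k, P k) := by
  classical
  have := Fintype.ofFinite ι
  choose F hF using hP
  refine ⟨Finset.univ.biUnion F, ?_⟩
  ext y
  simp only [Set.mem_iInter, Finset.mem_biUnion, Finset.mem_univ, true_and, Set.mem_ofPred_eq]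
  constructor
  · rintro h p ⟨k, hk⟩
    have := h k
    rw [hF k] at this
    exact this p hk
  · intro h k
    rw [hF k]
    exact fun p hp => h p ⟨k, hp⟩

theorem IsPolyhedron.inter {n : ℕ} {P Q : Set (Fin n → ℝ)} (hP : IsPolyhedron P)
    (hQ : IsPolyhedron Q) : IsPolyhedron (P ∩ Q) := by
  rw [Set.inter_eq_iInter]
  exact IsPolyhedron.iInter fun b => by cases b <;> assumption

theorem IsPolyhedron.biInter {n : ℕ} {ι : Type*} {s : Set ι} (hs : s.Finite)
    {P : ι → Set (Fin n → ℝ)} (hP : ∀ k ∈ s, IsPolyhedron (P k)) :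
    IsPolyhedron (⋂ k ∈ s, P k) := by
  have := hs.to_subtype
  rw [Set.biInter_eq_iInter]
  exact IsPolyhedron.iInter fun k => hP k k.2

theorem isPolyhedron_tropH (n : ℕ) : IsPolyhedron (tropH n) := by
  have h := (isPolyhedron_halfspace (fun _ : Fin n => (1 : ℝ)) 0).inter
    (isPolyhedron_halfspace (fun _ : Fin n => (-1 : ℝ)) 0)
  convert h using 1
  ext y
  simp only [tropH, Set.mem_ofPred_eq, Set.mem_inter_iff, one_mul, neg_mul, Finset.sum_neg_distrib,
    Left.neg_nonpos_iff]
  exact le_antisymm_iff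

theorem isPolyhedron_sub_le_sub {n : ℕ} (i j : Fin n) (p q : ℝ) :
    IsPolyhedron {y : Fin n → ℝ | y i - p ≤ y j - q} := by
  convert isPolyhedron_halfspace (Pi.single i 1 - Pi.single j 1 : Fin n → ℝ) (p - q) using 1
  ext y
  simp only [Set.mem_ofPred_eq, Pi.sub_apply, sub_mul, Finset.sum_sub_distrib, Pi.single_apply,
    ite_mul, one_mul, zero_mul, Finset.sum_ite_eq', Finset.mem_univ, if_true]
  constructor <;> intro h <;> linarith

/-! ### The local faces of a Voronoi cell and their dimension -/

/-- The polyhedron of the `y` in the hyperplane such that, for each `a ∈ T`, the coordinate `ψ a`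
of `y - a` is the largest one, and it does not exceed the coordinate `ψ b` of `y - b` for any
`b ∈ D`. -/
def cellFace {n : ℕ} (D T : Set (Fin n → ℝ)) (ψ : (Fin n → ℝ) → Fin n) : Set (Fin n → ℝ) :=
  {y | y ∈ tropH n ∧ (∀ a ∈ T, ∀ i, y i - a i ≤ y (ψ a) - a (ψ a)) ∧
    ∀ a ∈ T, ∀ b ∈ D, y (ψ a) - a (ψ a) ≤ y (ψ b) - b (ψ b)}

theorem isPolyhedron_cellFace {n : ℕ} {D T : Set (Fin n → ℝ)} (hD : D.Finite) (hT : T.Finite)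
    (ψ : (Fin n → ℝ) → Fin n) : IsPolyhedron (cellFace D T ψ) := by
  have h := (isPolyhedron_tropH n).inter
    ((IsPolyhedron.biInter hT (P := fun a => ⋂ i, {y | y i - a i ≤ y (ψ a) - a (ψ a)})
      fun a _ => IsPolyhedron.iInter fun i => isPolyhedron_sub_le_sub i (ψ a) _ _).inter
    (IsPolyhedron.biInter hT
      (P := fun a => ⋂ b ∈ D, {y | y (ψ a) - a (ψ a) ≤ y (ψ b) - b (ψ b)})
      fun a _ => IsPolyhedron.biInter hD fun b _ => isPolyhedron_sub_le_sub (ψ a) (ψ b) _ _))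
  convert h using 1
  ext y
  simp only [cellFace, Set.mem_ofPred_eq, Set.mem_inter_iff, Set.mem_iInter]

theorem cellFace_congr {n : ℕ} {D T : Set (Fin n → ℝ)} (hTD : T ⊆ D)
    {ψ φ : (Fin n → ℝ) → Fin n} (h : Set.EqOn ψ φ D) : cellFace D T ψ = cellFace D T φ := by
  ext y
  refine and_congr_right fun _ => and_congr ?_ ?_
  · exact forall₂_congr fun a ha => by rw [h (hTD ha)]
  · exact forall₂_congr fun a ha => forall₂_congr fun b hb => by rw [h (hTD ha), h hb]

theorem finite_setOf_cellFace {n : ℕ} {D T : Set (Fin n → ℝ)} (hD : D.Finite) (hTD : T ⊆ D)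
    (p : ((Fin n → ℝ) → Fin n) → Prop) : {P | ∃ ψ, p ψ ∧ P = cellFace D T ψ}.Finite := by
  classical
  have := hD.to_subtype
  rcases isEmpty_or_nonempty (Fin n) with he | ⟨⟨i₀⟩⟩
  · refine Set.Finite.subset Set.finite_empty ?_
    rintro P ⟨ψ, -⟩
    exact he.elim (ψ 0)
  · refine (Set.finite_range fun φ : D → Fin n =>
      cellFace D T fun b => if h : b ∈ D then φ ⟨b, h⟩ else i₀).subset ?_
    rintro P ⟨ψ, -, rfl⟩
    exact ⟨fun b => ψ b, cellFace_congr hTD fun b hb => by simp [hb]⟩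

/-- The vectors in the hyperplane whose coordinates in `J` all agree. -/
def constOnSubmodule {n : ℕ} (J : Set (Fin n)) : Submodule ℝ (Fin n → ℝ) where
  carrier := {v | v ∈ tropH n ∧ ∀ i ∈ J, ∀ j ∈ J, v i = v j}
  zero_mem' := by simp [tropH]
  add_mem' := by
    rintro v w ⟨hv, hv'⟩ ⟨hw, hw'⟩
    refine ⟨by simpa using add_smul_mem_tropH hv hw 1, fun i hi j hj => ?_⟩
    simp [hv' i hi j hj, hw' i hi j hj]
  smul_mem' := by
    rintro c v ⟨hv, hv'⟩
    have h0 : (0 : Fin n → ℝ) ∈ tropH n := by simp [tropH]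
    refine ⟨by simpa using add_smul_mem_tropH h0 hv c, fun i hi j hj => ?_⟩
    simp [hv' i hi j hj]

/-- A vector of `constOnSubmodule J` is determined by the differences of its coordinates outside
`J` with its common coordinate on `J`, and these are arbitrary. -/
theorem finrank_constOnSubmodule {n : ℕ} {J : Set (Fin n)} (hJ : J.Nonempty) :
    Module.finrank ℝ (constOnSubmodule J) = n - J.ncard := by
  classical
  obtain ⟨j₀, hj₀⟩ := hJ
  have hn : 1 ≤ n := j₀.pos
  have hn0 : (n : ℝ) ≠ 0 := by positivity
  let L : constOnSubmodule J →ₗ[ℝ] ((Jᶜ : Set (Fin n)) → ℝ) :=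
    { toFun := fun v i => v.1 i - v.1 j₀
      map_add' := fun v w => by ext i; simp; ring
      map_smul' := fun c v => by ext i; simp; ring }
  have hL : Function.Bijective L := by
    constructor
    · rw [injective_iff_map_eq_zero]
      intro v hv
      have hconst : ∀ i, v.1 i = v.1 j₀ := fun i => by
        by_cases hi : i ∈ J
        · exact v.2.2 i hi j₀ hj₀
        · exact sub_eq_zero.1 (congrFun hv ⟨i, hi⟩)
      have hsum : ∑ i, v.1 i = 0 := v.2.1
      simp only [hconst, Finset.sum_const, Finset.card_univ, Fintype.card_fin, nsmul_eq_mul,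
        mul_eq_zero, hn0, false_or] at hsum
      ext i
      simp [hconst i, hsum]
    · intro f
      let w : Fin n → ℝ := fun i => if h : i ∈ Jᶜ then f ⟨i, h⟩ else 0
      have hw : ∀ i ∈ J, w i = 0 := fun i hi => dif_neg (by simpa using hi)
      refine ⟨⟨fun i => w i - (∑ j, w j) / n, sum_sub_average hn w, fun i hi j hj => by
        simp only [hw i hi, hw j hj]⟩, ?_⟩
      ext i
      have hi : w i = f i := dif_pos i.2
      simp only [L, LinearMap.coe_mk, AddHom.coe_mk, hi, hw j₀ hj₀]
      ring
  rw [(LinearEquiv.ofBijective L hL).finrank_eq, Module.finrank_fintype_fun_eq_card,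
    ← Nat.card_eq_fintype_card, Nat.card_coe_set_eq, Set.ncard_compl]
  simp

theorem IsStrictIn.eventually_mem_cellFace {n : ℕ} {D T : Set (Fin n → ℝ)} (hD : D.Finite)
    (hTD : T ⊆ D) {ψ : (Fin n → ℝ) → Fin n} {z v : Fin n → ℝ} (hz : z ∈ cellFace D T ψ)
    (hs : IsStrictIn D T ψ z) (hv : v ∈ constOnSubmodule (ψ '' T)) :
    ∀ᶠ t in 𝓝 (0 : ℝ), z + t • v ∈ cellFace D T ψ := by
  have hT := hD.subset hTD
  have h1 : ∀ᶠ t in 𝓝 (0 : ℝ), ∀ a ∈ T, ∀ i,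
      (z + t • v) i - a i ≤ (z + t • v) (ψ a) - a (ψ a) := by
    refine (eventually_all_finite hT).2 fun a ha => eventually_all.2 fun i => ?_
    by_cases hi : i = ψ a
    · exact Eventually.of_forall fun t => by rw [hi]
    · have hlt := hs.1 a ha i hi
      refine (ContinuousAt.eventually_lt (f := fun t : ℝ => (z + t • v) i - a i)
        (g := fun t : ℝ => (z + t • v) (ψ a) - a (ψ a)) ?_ ?_ (by simpa using hlt)).mono
        fun t h => h.le
      · simp only [Pi.add_apply, Pi.smul_apply, smul_eq_mul]; fun_prop
      · simp only [Pi.add_apply, Pi.smul_apply, smul_eq_mul]; fun_prop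
  have h2 : ∀ᶠ t in 𝓝 (0 : ℝ), ∀ a ∈ T, ∀ b ∈ D,
      (z + t • v) (ψ a) - a (ψ a) ≤ (z + t • v) (ψ b) - b (ψ b) := by
    refine (eventually_all_finite hT).2 fun a ha => (eventually_all_finite hD).2 fun b hb => ?_
    by_cases hbT : b ∈ T
    · have he := hv.2 (ψ a) ⟨a, ha, rfl⟩ (ψ b) ⟨b, hbT, rfl⟩
      have hle := hz.2.2 a ha b hb
      refine Eventually.of_forall fun t => ?_
      simp only [Pi.add_apply, Pi.smul_apply, smul_eq_mul, he]
      linarith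
    · have hlt := hs.2 a ha b ⟨hb, hbT⟩
      refine (ContinuousAt.eventually_lt (f := fun t : ℝ => (z + t • v) (ψ a) - a (ψ a))
        (g := fun t : ℝ => (z + t • v) (ψ b) - b (ψ b)) ?_ ?_ (by simpa using hlt)).mono
        fun t h => h.le
      · simp only [Pi.add_apply, Pi.smul_apply, smul_eq_mul]; fun_prop
      · simp only [Pi.add_apply, Pi.smul_apply, smul_eq_mul]; fun_prop
  filter_upwards [h1, h2] with t h1 h2
  exact ⟨add_smul_mem_tropH hz.1 hv.1 t, h1, h2⟩

theorem direction_affineSpan_cellFace {n : ℕ} {D T : Set (Fin n → ℝ)} (hD : D.Finite)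
    (hTD : T ⊆ D) {ψ : (Fin n → ℝ) → Fin n} {z : Fin n → ℝ} (hz : z ∈ cellFace D T ψ)
    (hs : IsStrictIn D T ψ z) :
    (affineSpan ℝ (cellFace D T ψ)).direction = constOnSubmodule (ψ '' T) := by
  apply le_antisymm
  · rw [direction_affineSpan, vectorSpan_def, Submodule.span_le]
    rintro _ ⟨y, hy, y', hy', rfl⟩
    refine ⟨?_, ?_⟩
    · have := add_smul_mem_tropH hy.1 hy'.1 (-1)
      simpa [sub_eq_add_neg] using this
    · rintro _ ⟨a, ha, rfl⟩ _ ⟨b, hb, rfl⟩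
      have h1 := hy.2.2 a ha b (hTD hb)
      have h2 := hy.2.2 b hb a (hTD ha)
      have h3 := hy'.2.2 a ha b (hTD hb)
      have h4 := hy'.2.2 b hb a (hTD ha)
      simp only [vsub_eq_sub, Pi.sub_apply]
      linarith
  · intro v hv
    have hpos : ∀ᶠ t in 𝓝[>] (0 : ℝ), t ∈ Set.Ioi 0 := self_mem_nhdsWithin
    obtain ⟨t, ht, ht0⟩ := (((hs.eventually_mem_cellFace hD hTD hz hv).filter_mono
      nhdsWithin_le_nhds).and hpos).exists
    have := AffineSubspace.vsub_mem_direction (subset_affineSpan ℝ _ ht)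
      (subset_affineSpan ℝ _ hz)
    rw [vsub_eq_sub, add_sub_cancel_left] at this
    exact (Submodule.smul_mem_iff _ (ne_of_gt ht0)).1 this

theorem mem_cellFace_self {n : ℕ} (hn : 1 ≤ n) {S : Set (Fin n → ℝ)} (hSH : S ⊆ tropH n)
    {x : Fin n → ℝ} (hx : x ∈ tropH n) {T : Set (Fin n → ℝ)} (hT : T ⊆ nearestSites S x)
    {ψ : (Fin n → ℝ) → Fin n} (hψ : IsActiveChoice x (nearestSites S x) ψ) :
    x ∈ cellFace (nearestSites S x) T ψ := by
  refine ⟨hx, fun a ha i => ?_, fun a ha b hb => ?_⟩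
  · rw [hψ a (hT ha)]
    exact le_excess x a i
  · rw [hψ a (hT ha), hψ b hb]
    exact (excess_eq_of_mem_nearestSites hn hSH hx (hT ha) hb).le

theorem finrank_affineSpan_cellFace {n : ℕ} (hn : 1 ≤ n) {S : Set (Fin n → ℝ)}
    (hSH : S ⊆ tropH n) (hgen : InGeneralPosition S) {x : Fin n → ℝ} (hx : x ∈ tropH n)
    {T : Set (Fin n → ℝ)} (hT : T ⊆ nearestSites S x) (hTne : T.Nonempty)
    {ψ : (Fin n → ℝ) → Fin n} (hψ : IsActiveChoice x (nearestSites S x) ψ) :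
    Module.finrank ℝ (affineSpan ℝ (cellFace (nearestSites S x) T ψ)).direction
      = n - T.ncard := by
  have hinj := hψ.injOn hn hSH hgen hx
  obtain ⟨ε, hs⟩ := (eventually_perturb_strict hn hSH hgen hx hT hψ).exists
  have hx' := mem_cellFace_self hn hSH hx hT hψ
  have hz : x + ε • perturbDir (nearestSites S x) T ψ ∈ cellFace (nearestSites S x) T ψ := by
    refine ⟨add_smul_mem_tropH hx (perturbDir_mem_tropH hn _ _ _) ε, fun a ha i => ?_,
      fun a ha b hb => ?_⟩
    · rw [← hs.excess_eq hn ha]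
      exact le_excess _ a i
    · by_cases hbT : b ∈ T
      · have := hx'.2.2 a ha b hb
        simp only [Pi.add_apply, Pi.smul_apply, smul_eq_mul,
          perturbDir_apply_eq (D := nearestSites S x) (ψ := ψ) ha hbT]
        linarith
      · exact (hs.2 a ha b ⟨hb, hbT⟩).le
  rw [direction_affineSpan_cellFace (finite_nearestSites hn hSH hgen hx) hT hz hs,
    finrank_constOnSubmodule (hTne.image ψ), (hinj.mono hT).ncard_image]

/-- A set that near each of its points consists of the points of the hyperplane whose nearest sites
include `T` is a polyhedral set of pure dimension `n - |T|`. -/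
theorem hasPurePolyhedralDim_of_eventually {n : ℕ} (hn : 1 ≤ n) {S : Set (Fin n → ℝ)}
    (hSH : S ⊆ tropH n) (hne : S.Nonempty) (hdisc : IsDiscreteSites S)
    (hgen : InGeneralPosition S) {T : Set (Fin n → ℝ)} (hTne : T.Nonempty)
    {X : Set (Fin n → ℝ)} (hX : X.Nonempty)
    (hloc : ∀ x ∈ X, ∀ᶠ y in 𝓝 x, y ∈ X ↔ y ∈ tropH n ∧ T ⊆ nearestSites S y) :
    HasPurePolyhedralDim X (n - T.ncard) := by
  refine ⟨hX, fun x hxX => ?_⟩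
  obtain ⟨hx, hT⟩ := (hloc x hxX).self_of_nhds.1 hxX
  have hD := finite_nearestSites hn hSH hgen hx
  refine ⟨_, (hloc x hxX).and ((eventually_nearestSites_subset hn hSH hne hdisc hx).and
    (eventually_active hn hD x)),
    {P | ∃ ψ, IsActiveChoice x (nearestSites S x) ψ ∧ P = cellFace (nearestSites S x) T ψ},
    finite_setOf_cellFace hD hT _, ?_, ?_⟩
  · rintro _ ⟨ψ, hψ, rfl⟩
    exact ⟨isPolyhedron_cellFace hD (hD.subset hT) ψ, ⟨x, mem_cellFace_self hn hSH hx hT hψ⟩,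
      finrank_affineSpan_cellFace hn hSH hgen hx hT hTne hψ⟩
  · ext y
    refine and_congr_left ?_
    rintro ⟨hy1, hy2, hy3⟩
    rw [hy1]
    constructor
    · rintro ⟨hy, hTy⟩
      -- Coordinates attaining the excesses at `y` are active at `x` and give a face through `y`.
      obtain ⟨ψ, hψ⟩ := exists_isActiveChoice hn y (nearestSites S x)
      refine ⟨_, ⟨ψ, fun b hb => hy3 b hb _ (hψ b hb), rfl⟩, hy, fun a ha i => ?_,
        fun a ha b hb => ?_⟩
      · rw [hψ a (hT ha)]
        exact le_excess y a i
      · rw [hψ a (hT ha), hψ b hb]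
        exact ((mem_nearestSites_iff hn hSH hy).1 (hTy ha)).2 b hb.1
    · rintro ⟨_, ⟨ψ, hψ, rfl⟩, hy, hmax, hle⟩
      refine ⟨hy, fun a ha => (mem_nearestSites_iff hn hSH hy).2 ⟨(hT ha).1, fun c hc => ?_⟩⟩
      -- A nearest site of `y` is nearest to `x`, so the face compares its excess with that of `a`.
      obtain ⟨b, hb⟩ := nearestSites_nonempty hn hSH hne hdisc hy
      calc excess y a ≤ y (ψ a) - a (ψ a) := excess_le hn (hmax a ha)
        _ ≤ y (ψ b) - b (ψ b) := hle a ha b (hy2 hy hb)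
        _ ≤ excess y b := le_excess y b _
        _ ≤ excess y c := ((mem_nearestSites_iff hn hSH hy).1 hb).2 c hc

/-! ### Voronoi cells and V-cells -/

theorem mainTheorem3 {n : ℕ} (hn : 1 ≤ n) (S : Set (Fin n → ℝ)) (hSH : S ⊆ tropH n)
    (hne : S.Nonempty) (hdisc : IsDiscreteSites S) (hgen : InGeneralPosition S) :
    voronoiCells S = closure '' vCells S ∧
    (∀ T ⊆ S, T.Nonempty → (⋂ a ∈ T, voronoiRegion S a) = closure (vCell S T)) ∧
    (∀ T ⊆ S, (vCell S T).Nonempty →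
      T.Finite ∧ T.ncard ≤ n ∧
      HasPurePolyhedralDim (vCell S T) (n - T.ncard) ∧
      HasPurePolyhedralDim (closure (vCell S T)) (n - T.ncard)) := by
  have hcl : ∀ T ⊆ S, T.Nonempty → (⋂ a ∈ T, voronoiRegion S a) = closure (vCell S T) :=
    fun T hTS hT => iInter_voronoiRegion_eq_closure hn hSH hne hdisc hgen hTS hT
  refine ⟨?_, hcl, ?_⟩
  · ext W
    constructor
    · rintro ⟨hW, T, hTS, hT, rfl⟩
      rw [hcl T hTS hT] at hW ⊢
      obtain ⟨x, hx, rfl⟩ := closure_nonempty_iff.1 hW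
      exact ⟨_, ⟨x, hx, rfl⟩, rfl⟩
    · rintro ⟨_, ⟨x, hx, rfl⟩, rfl⟩
      exact ⟨⟨x, subset_closure ⟨hx, rfl⟩⟩, nearestSites S x, fun a ha => ha.1,
        nearestSites_nonempty hn hSH hne hdisc hx,
        (hcl _ (fun a ha => ha.1) (nearestSites_nonempty hn hSH hne hdisc hx)).symm⟩
  · rintro T hTS hV
    have hTne : T.Nonempty := by
      obtain ⟨x, hx, rfl⟩ := hV
      exact nearestSites_nonempty hn hSH hne hdisc hx
    refine ⟨?_, ?_, ?_, ?_⟩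
    · obtain ⟨x, hx, rfl⟩ := hV
      exact finite_nearestSites hn hSH hgen hx
    · obtain ⟨x, hx, rfl⟩ := hV
      exact ncard_nearestSites_le hn hSH hgen hx
    · refine hasPurePolyhedralDim_of_eventually hn hSH hne hdisc hgen hTne hV ?_
      rintro x ⟨hx, hxT⟩
      filter_upwards [eventually_nearestSites_subset hn hSH hne hdisc hx] with y hy
      exact and_congr_right fun hyH => ⟨fun h => h.ge, fun h => (hxT ▸ hy hyH).antisymm h⟩
    · refine hasPurePolyhedralDim_of_eventually hn hSH hne hdisc hgen hTne hV.closure ?_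
      intro x _
      refine Eventually.of_forall fun y => ?_
      rw [← hcl T hTS hTne]
      exact mem_iInter_voronoiRegion_iff hTS hTne
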